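/- Let $\Lambda$ and $\Gamma$ be left and right noetherian rings and let ${}_\Lambda U_\Gamma$ be a bimodule, finitely generated as a left $\Lambda$-module and as a right $\Gamma$-module, which is faithfully balanced (the natural maps $\Lambda\to\mathrm{End}(U_\Gamma)$ and $\Gamma\to\mathrm{End}({}_\Lambda U)^{op}$ are isomorphisms) and selforthogonal ($\mathrm{Ext}^i_\Lambda(U,U)=0$ and $\mathrm{Ext}^i_\Gamma(U,U)=0$ for all $i\ge 1$). Write $\mathrm{mod}\,\Lambda$ (resp. $\mathrm{mod}\,\Gamma^{op}$) for the category of finitely generated left $\Lambda$-modules (resp. right $\Gamma$-modules). For $M$ in $\mathrm{mod}\,\Lambda$, $\mathrm{Ext}^i_\Lambda(M,U)$ is a right $\Gamma$-module, and for $N$ in $\mathrm{mod}\,\Gamma^{op}$, $\mathrm{Ext}^i_\Gamma(N,U)$ is a left $\Lambda$-module, through the action on $U$. For a module $A$ on either side, say that $\mathrm{grade}_U A\ge i$ if $\mathrm{Ext}^j(A,U)=0$ for all $0\le j<i$ ($\mathrm{Ext}$ being over $\Lambda$, resp. $\Gamma$), that $\mathrm{grade}_U A=g$ if $\mathrm{grade}_U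 A\ge g$ but not $\mathrm{grade}_UA\ge g+1$, and that $\mathrm{s.grade}_U A\ge i$ if $\mathrm{grade}_U B\ge i$ for every submodule $B$ of $A$. Suppose that $U$ is a Gorenstein bimodule, that is, $\mathrm{s.grade}_U\mathrm{Ext}^i_\Gamma(N,U)\ge i$ for all $N$ in $\mathrm{mod}\,\Gamma^{op}$ and $i\ge1$, and $\mathrm{s.grade}_U\mathrm{Ext}^i_\Lambda(M,U)\ge i$ for all $M$ in $\mathrm{mod}\,\Lambda$ and $i\ge1$. For an integer $g\ge 0$ let $\mathcal G_g(\mathrm{mod}\,\Lambda)$ and $\mathcal G_g(\mathrm{mod}\,\Gamma^{op})$ be the full subcategories of $\mathrm{mod}\,\Lambda$ and $\mathrm{mod}\,\Gamma^{op}$ of the modules $M$ with $\mathrm{grade}_UM=g$ (such modules are nonzero). Then: (1) If the right injective dimension $\mathrm{r.id}_\Gamma(U)$ equals $g$, then $M\cong\mathrm{Ext}^g_\Gamma(\mathrm{Ext}^g_\Lambda(M,U),U)$ as left $\Lambda$-modules for every $M\in\mathcal G_g(\mathrm{mod}\,\Lambda)$. (2) If $\mathrm{r.id}_\Gamma(U)=\mathrm{l.id}_\Lambda(U)=g$,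 then the functor $M\mapsto\mathrm{Ext}^g_\Lambda(M,U)$ maps $\mathcal G_g(\mathrm{mod}\,\Lambda)$ into $\mathcal G_g(\mathrm{mod}\,\Gamma^{op})$ and is a duality (contravariant equivalence) between these two categories. -/

import Mathlib

/-!
Conventions. A right `Γ`-module is a (left) module over `Γᵐᵒᵖ`, so a `Λ`-`Γ`-bimodule is an abelian
group `U` with commuting module structures over `Λ` and `Γᵐᵒᵖ`. Most definitions below are made for
an abelian group `U` with commuting (left) module structures over two rings `R` and `S`; they are
used with `(R, S) = (Λ, Γᵐᵒᵖ)` and with `(R, S) = (Γᵐᵒᵖ, Λ)`.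
-/

open CategoryTheory CategoryTheory.Abelian Opposite

universe u

noncomputable section

namespace DualTheory

section Ext

variable (R S U : Type u) [Ring R] [Ring S] [AddCommGroup U] [Module R U] [Module S U]
  [SMulCommClass S R U]

/-- Multiplication by `s : S`, as an endomorphism of the `R`-module `U`. -/
def smulHom (s : S) : ModuleCat.of R U ⟶ ModuleCat.of R U :=
  ModuleCat.ofHom (Module.toModuleEnd R U s)

/-- The `S`-module structure on `Ext^i_R(M, U)`: `s : S` acts by composition with multiplication
by `s` on `U`. -/
abbrev extModuleStructure (M : ModuleCat.{u} R) (i : ℕ) :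
    Module S (Ext M (ModuleCat.of R U) i) where
  smul s e := e.comp (Ext.mk₀ (smulHom R S U s)) (add_zero i)
  one_smul e := by
    change e.comp (Ext.mk₀ (smulHom R S U 1)) (add_zero i) = e
    have : smulHom R S U 1 = 𝟙 _ := by simp only [smulHom, map_one]; rfl
    rw [this, Ext.comp_mk₀_id]
  mul_smul s t e := by
    change e.comp (Ext.mk₀ (smulHom R S U (s * t))) (add_zero i) =
      (e.comp (Ext.mk₀ (smulHom R S U t)) (add_zero i)).comp
        (Ext.mk₀ (smulHom R S U s)) (add_zero i)
    have : smulHom R S U (s * t) = smulHom R S U t ≫ smulHom R S U s := by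
      simp only [smulHom, map_mul]; rfl
    rw [this, Ext.comp_assoc_of_third_deg_zero, Ext.mk₀_comp_mk₀]
  smul_zero s := Ext.zero_comp _ _ (Ext.mk₀ (smulHom R S U s)) _ (add_zero i)
  smul_add s e f := Ext.add_comp e f (Ext.mk₀ (smulHom R S U s)) (add_zero i)
  add_smul s t e := by
    change e.comp (Ext.mk₀ (smulHom R S U (s + t))) (add_zero i) =
      e.comp (Ext.mk₀ (smulHom R S U s)) (add_zero i) +
        e.comp (Ext.mk₀ (smulHom R S U t)) (add_zero i)
    have : smulHom R S U (s + t) = smulHom R S U s + smulHom R S U t := by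
      simp only [smulHom, map_add]; rfl
    rw [this, Ext.mk₀_add, Ext.comp_add]
  zero_smul e := by
    change e.comp (Ext.mk₀ (smulHom R S U 0)) (add_zero i) =
      (0 : Ext M (ModuleCat.of R U) i)
    have : smulHom R S U 0 = 0 := by simp only [smulHom, map_zero]; rfl
    rw [this, Ext.mk₀_zero, Ext.comp_zero]

/-- The abelian group `Ext^i_R(M, U)`, considered as an `S`-module through the action of `S` on `U`
(see `extModuleStructure`). -/
def ExtModule (R _S U : Type u) [Ring R] [AddCommGroup U] [Module R U] (M : ModuleCat.{u} R)
    (i : ℕ) : Type u :=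
  Ext M (ModuleCat.of R U) i

instance (M : ModuleCat.{u} R) (i : ℕ) : AddCommGroup (ExtModule R S U M i) :=
  inferInstanceAs (AddCommGroup (Ext M (ModuleCat.of R U) i))

instance (M : ModuleCat.{u} R) (i : ℕ) : Module S (ExtModule R S U M i) :=
  extModuleStructure R S U M i

/-- The `S`-linear map `Ext^i_R(N, U) → Ext^i_R(M, U)` induced by `f : M ⟶ N`. -/
def extMap {M N : ModuleCat.{u} R} (f : M ⟶ N) (i : ℕ) :
    ExtModule R S U N i →ₗ[S] ExtModule R S U M i where
  toFun e := (Ext.mk₀ f).comp e (zero_add i)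
  map_add' e e' := Ext.comp_add (C := ModuleCat.{u} R) (Ext.mk₀ f) e e' (zero_add i)
  map_smul' s e :=
    (Ext.comp_assoc_of_third_deg_zero (C := ModuleCat.{u} R) (Ext.mk₀ f) e
      (Ext.mk₀ (smulHom R S U s)) (zero_add i)).symm

/-- The contravariant functor `M ↦ Ext^i_R(M, U)` from `R`-modules to `S`-modules. -/
def extFunctor (i : ℕ) : (ModuleCat.{u} R)ᵒᵖ ⥤ ModuleCat.{u} S where
  obj M := ModuleCat.of S (ExtModule R S U M.unop i)
  map f := ModuleCat.ofHom (extMap R S U f.unop i)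
  map_id _ := ModuleCat.hom_ext (LinearMap.ext fun e => Ext.mk₀_id_comp (C := ModuleCat.{u} R) e)
  map_comp f g := ModuleCat.hom_ext (LinearMap.ext fun e =>
    (Ext.mk₀_comp_mk₀_assoc (C := ModuleCat.{u} R) g.unop f.unop e).symm)

end Ext

section Grade

variable (R U : Type u) [Ring R] [AddCommGroup U] [Module R U]

/-- `grade_U M ≥ i`: `Ext^j_R(M, U) = 0` for all `0 ≤ j < i`. -/
def GradeGE (M : ModuleCat.{u} R) (i : ℕ) : Prop :=
  ∀ j < i, Subsingleton (Ext M (ModuleCat.of R U) j)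

/-- `s.grade_U M ≥ i`: every submodule of `M` has grade at least `i`. -/
def StrongGradeGE (M : ModuleCat.{u} R) (i : ℕ) : Prop :=
  ∀ B : Submodule R M, GradeGE R U (ModuleCat.of R B) i

/-- `grade_U M = g`. (The zero module has infinite grade.) -/
def GradeEq (M : ModuleCat.{u} R) (g : ℕ) : Prop :=
  GradeGE R U M g ∧ ¬ GradeGE R U M (g + 1)

/-- The finitely generated `R`-modules `M` with `grade_U M = g`. -/
def gradeSubcategory (g : ℕ) : ObjectProperty (ModuleCat.{u} R) :=
  fun M => Module.Finite R M ∧ GradeEq R U M g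

end Grade

section Gorenstein

variable (R S U : Type u) [Ring R] [Ring S] [AddCommGroup U] [Module R U] [Module S U]
  [SMulCommClass R S U]

/-- The `R`-module `U` is `k`-Gorenstein (with `S` in the role of its endomorphism ring):
`s.grade_U Ext^i_S(N, U) ≥ i` for every finitely generated `S`-module `N` and `1 ≤ i ≤ k`. -/
def IsKGorenstein (k : ℕ) : Prop :=
  ∀ N : ModuleCat.{u} S, Module.Finite S N → ∀ i : ℕ, 1 ≤ i → i ≤ k →
    StrongGradeGE R U ((extFunctor S R U i).obj (op N)) i

/-- The `R`-module `U` is Gorenstein: `k`-Gorenstein for all `k ≥ 1`. -/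
def IsGorenstein : Prop :=
  ∀ k : ℕ, 1 ≤ k → IsKGorenstein R S U k

end Gorenstein

section Bimodule

variable (Λ Γ U : Type u) [Ring Λ] [Ring Γ] [AddCommGroup U] [Module Λ U] [Module Γᵐᵒᵖ U]
  [SMulCommClass Λ Γᵐᵒᵖ U] [SMulCommClass Γᵐᵒᵖ Λ U]

/-- The natural maps `Λ → End(U_Γ)` and `Γᵒᵖ → End(_ΛU)` are isomorphisms. -/
def IsFaithfullyBalanced : Prop :=
  Function.Bijective (Module.toModuleEnd Γᵐᵒᵖ U : Λ →+* Module.End Γᵐᵒᵖ U) ∧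
    Function.Bijective (Module.toModuleEnd Λ U : Γᵐᵒᵖ →+* Module.End Λ U)

/-- `Ext^i_Λ(U, U) = 0` and `Ext^i_Γ(U, U) = 0` for all `i ≥ 1`. -/
def IsSelforthogonal : Prop :=
  ∀ i : ℕ, 1 ≤ i →
    Subsingleton (Ext (ModuleCat.of Λ U) (ModuleCat.of Λ U) i) ∧
      Subsingleton (Ext (ModuleCat.of Γᵐᵒᵖ U) (ModuleCat.of Γᵐᵒᵖ U) i)

/-- Both `_ΛU` and `U_Γ` are Gorenstein. -/
def IsGorensteinBimodule : Prop :=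
  IsGorenstein Λ Γᵐᵒᵖ U ∧ IsGorenstein Γᵐᵒᵖ Λ U

end Bimodule

end DualTheory

end

noncomputable section

namespace DualTheory

lemma extClass_comp_mk₀_eq_zero_iff {C : Type*} [Category* C] [Abelian C] [HasExt.{u} C]
    {T : ShortComplex C} (hT : T.ShortExact) {Y : C} (f : T.X₁ ⟶ Y) :
    hT.extClass.comp (Ext.mk₀ f) (add_zero 1) = 0 ↔ ∃ f', T.f ≫ f' = f := by
  constructor
  · intro hf
    obtain ⟨x, hx⟩ := Ext.contravariant_sequence_exact₁ hT Y (Ext.mk₀ f) _ hf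
    obtain ⟨f', rfl⟩ := (Ext.mk₀_bijective _ _).2 x
    exact ⟨f', (Ext.mk₀_bijective _ _).1 (by simpa using hx)⟩
  · rintro ⟨f', rfl⟩
    rw [← Ext.mk₀_comp_mk₀]
    exact hT.extClass_comp_assoc _

section Syzygy

universe v w

/-- A sequence of short exact sequences `0 ⟶ Z (i + 1) ⟶ P i ⟶ Z i ⟶ 0`, that is, a (not
necessarily projective) resolution of `Z 0` together with its syzygies. -/
structure SyzygySequence (C : Type w) [Category.{v} C] [Abelian C] where
  Z : ℕ → C
  P : ℕ → C
  ι : ∀ i, Z (i + 1) ⟶ P i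
  π : ∀ i, P i ⟶ Z i
  zero : ∀ i, ι i ≫ π i = 0
  shortExact : ∀ i, (ShortComplex.mk (ι i) (π i) (zero i)).ShortExact

namespace SyzygySequence

variable {C : Type w} [Category.{v} C] [Abelian C]

/-- The sequence starting with the first syzygy. -/
def tail (r : SyzygySequence C) : SyzygySequence C where
  Z i := r.Z (i + 1)
  P i := r.P (i + 1)
  ι i := r.ι (i + 1)
  π i := r.π (i + 1)
  zero i := r.zero (i + 1)
  shortExact i := r.shortExact (i + 1)

/-- A morphism of syzygy sequences. -/
structure Hom (r r' : SyzygySequence C) where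
  z : ∀ i, r.Z i ⟶ r'.Z i
  p : ∀ i, r.P i ⟶ r'.P i
  ι_comm : ∀ i, z (i + 1) ≫ r'.ι i = r.ι i ≫ p i
  π_comm : ∀ i, p i ≫ r'.π i = r.π i ≫ z i

/-- The morphism induced on tails. -/
def Hom.tail {r r' : SyzygySequence C} (φ : Hom r r') : Hom r.tail r'.tail where
  z i := φ.z (i + 1)
  p i := φ.p (i + 1)
  ι_comm i := φ.ι_comm (i + 1)
  π_comm i := φ.π_comm (i + 1)

lemma exists_lift_step (r r' : SyzygySequence C) (i : ℕ) [Projective (r.P i)]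
    (f : r.Z i ⟶ r'.Z i) :
    ∃ (p : r.P i ⟶ r'.P i) (f' : r.Z (i + 1) ⟶ r'.Z (i + 1)),
      f' ≫ r'.ι i = r.ι i ≫ p ∧ p ≫ r'.π i = r.π i ≫ f := by
  have : Epi (r'.π i) := (r'.shortExact i).epi_g
  have : Mono (r'.ι i) := (r'.shortExact i).mono_f
  have hp := Projective.factorThru_comp (r.π i ≫ f) (r'.π i)
  refine ⟨_, (r'.shortExact i).exact.lift (r.ι i ≫ Projective.factorThru (r.π i ≫ f) (r'.π i)) ?_,
    (r'.shortExact i).exact.lift_f _ _, hp⟩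
  change (_ ≫ _) ≫ r'.π i = 0
  rw [Category.assoc, hp, ← Category.assoc, r.zero, Limits.zero_comp]

/-- A morphism between the resolved objects lifts to the syzygy sequences. -/
lemma exists_lift (r r' : SyzygySequence C) (hP : ∀ i, Projective (r.P i))
    (f : r.Z 0 ⟶ r'.Z 0) : ∃ φ : Hom r r', φ.z 0 = f := by
  choose p f' h₁ h₂ using fun i => exists_lift_step r r' i
  let z : ∀ i, r.Z i ⟶ r'.Z i := fun i => Nat.rec f (fun i fi => f' i fi) i
  exact ⟨⟨z, fun i => p i (z i), fun i => h₁ i (z i), fun i => h₂ i (z i)⟩, rfl⟩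

variable [HasExt.{u} C]

/-- The Yoneda class in `Ext^n(Z 0, Z n)` of the first `n` terms. -/
def yonedaClass (r : SyzygySequence C) : ∀ n : ℕ, Ext (r.Z 0) (r.Z n) n
  | 0 => Ext.mk₀ (𝟙 _)
  | n + 1 => (yonedaClass r n).comp (r.shortExact n).extClass rfl

lemma yonedaClass_naturality {r r' : SyzygySequence C} (φ : Hom r r') (n : ℕ) :
    (r.yonedaClass n).comp (Ext.mk₀ (φ.z n)) (add_zero n) =
      (Ext.mk₀ (φ.z 0)).comp (r'.yonedaClass n) (zero_add n) := by
  induction n with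
  | zero => simp [yonedaClass]
  | succ n ih =>
    have h := (r.shortExact n).extClass_naturality (r'.shortExact n)
      ⟨φ.z (n + 1), φ.p n, φ.z n, φ.ι_comm n, φ.π_comm n⟩
    dsimp only at h
    dsimp only [yonedaClass]
    rw [Ext.comp_assoc_of_third_deg_zero]
    erw [h]
    rw [← Ext.comp_assoc_of_second_deg_zero]
    erw [ih]
    rw [Ext.comp_assoc _ _ _ (zero_add n) rfl (by lia)]

variable {r : SyzygySequence C} {Y : C}

lemma yonedaClass_comp_surjective (hP : ∀ i j, Subsingleton (Ext (r.P i) Y (j + 1)))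
    (n j k : ℕ) (hk : n + j = k) (y : Ext (r.Z 0) Y k) :
    ∃ x : Ext (r.Z n) Y j, (r.yonedaClass n).comp x hk = y := by
  induction n generalizing j with
  | zero =>
    obtain rfl : j = k := by lia
    exact ⟨y, by simp [yonedaClass]⟩
  | succ n ih =>
    obtain ⟨x', rfl⟩ := ih (j + 1) (by lia)
    obtain ⟨x, rfl⟩ := Ext.contravariant_sequence_exact₃ (r.shortExact n) Y x'
      (Subsingleton.elim (h := hP n j) _ _) (add_comm 1 j)
    exact ⟨x, Ext.comp_assoc _ _ _ rfl _ (by lia)⟩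

lemma eq_zero_of_yonedaClass_comp_eq_zero (hP : ∀ i j, Subsingleton (Ext (r.P i) Y (j + 1)))
    (n j k : ℕ) (hk : n + (j + 1) = k) (x : Ext (r.Z n) Y (j + 1))
    (hx : (r.yonedaClass n).comp x hk = 0) : x = 0 := by
  induction n generalizing j with
  | zero =>
    obtain rfl : j + 1 = k := by lia
    simpa [yonedaClass] using hx
  | succ n ih =>
    dsimp only [yonedaClass] at hx
    rw [Ext.comp_assoc _ _ _ rfl (add_comm 1 (j + 1)) (by lia)] at hx
    obtain ⟨x₂, rfl⟩ := Ext.contravariant_sequence_exact₁ (r.shortExact n) Y x _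
      (ih (j + 1) (by lia) _ hx)
    rw [Subsingleton.elim (h := hP n j) x₂ 0, Ext.comp_zero]

lemma yonedaClass_comp_mk₀_eq_zero_iff (hP : ∀ i j, Subsingleton (Ext (r.P i) Y (j + 1)))
    (n : ℕ) (h : r.Z (n + 1) ⟶ Y) :
    (r.yonedaClass (n + 1)).comp (Ext.mk₀ h) (add_zero _) = 0 ↔
      ∃ h' : r.P n ⟶ Y, r.ι n ≫ h' = h := by
  dsimp only [yonedaClass]
  rw [Ext.comp_assoc _ _ _ rfl (add_zero 1) (by lia)]
  rw [← extClass_comp_mk₀_eq_zero_iff (r.shortExact n)]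
  exact ⟨eq_zero_of_yonedaClass_comp_eq_zero hP n 0 _ rfl _, fun hx => by rw [hx, Ext.comp_zero]⟩

end SyzygySequence

end Syzygy

lemma moduleCat_shortExact {R : Type u} [Ring R] (T : ShortComplex (ModuleCat.{u} R))
    (hf : Function.Injective T.f) (hex : ∀ x, T.g x = 0 → ∃ y, T.f y = x)
    (hg : Function.Surjective T.g) : T.ShortExact where
  exact := T.moduleCat_exact_iff.2 hex
  mono_f := (ModuleCat.mono_iff_injective _).2 hf
  epi_g := (ModuleCat.epi_iff_surjective _).2 hg

section Dual

variable {R : Type u} (S U : Type u) [Ring R] [Ring S] [AddCommGroup U] [Module R U] [Module S U]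
  [SMulCommClass R S U]

/-- The `S`-module `Hom_R(M, U)`. -/
abbrev dual (M : ModuleCat.{u} R) : ModuleCat.{u} S := ModuleCat.of S (M →ₗ[R] U)

/-- The map `Hom_R(N, U) ⟶ Hom_R(M, U)` induced by `f : M ⟶ N`. -/
def dualMap {M N : ModuleCat.{u} R} (f : M ⟶ N) : dual S U N ⟶ dual S U M :=
  ModuleCat.ofHom
    { toFun := fun h => h ∘ₗ f.hom
      map_add' := fun _ _ => rfl
      map_smul' := fun _ _ => rfl }

lemma dualMap_comp {M N L : ModuleCat.{u} R} (f : M ⟶ N) (g : N ⟶ L) :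
    dualMap S U (f ≫ g) = dualMap S U g ≫ dualMap S U f := rfl

/-- Evaluation at `m : M`, as a morphism `Hom_R(M, U) ⟶ U`. -/
def evalAt {M : ModuleCat.{u} R} (m : M) : dual S U M ⟶ ModuleCat.of S U :=
  ModuleCat.ofHom
    { toFun := fun h => h m
      map_add' := fun _ _ => rfl
      map_smul' := fun _ _ => rfl }

lemma dualMap_comp_evalAt {M N : ModuleCat.{u} R} (f : M ⟶ N) (m : M) :
    dualMap S U f ≫ evalAt S U m = evalAt S U (f m) := rfl

/-- The natural map from `M` to its bidual is surjective. -/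
def EvalSurjective (M : ModuleCat.{u} R) : Prop :=
  ∀ ψ : dual S U M ⟶ ModuleCat.of S U, ∃ m, evalAt S U m = ψ

lemma dualMap_π_injective (r : SyzygySequence (ModuleCat.{u} R)) (n : ℕ) :
    Function.Injective (dualMap S U (r.π n)) := by
  have : Epi (r.π n) := (r.shortExact n).epi_g
  intro h h' e
  refine LinearMap.ext fun z => ?_
  obtain ⟨p, rfl⟩ := (ModuleCat.epi_iff_surjective (r.π n)).1 inferInstance z
  exact LinearMap.congr_fun e p

lemma exists_dualMap_π_eq (r : SyzygySequence (ModuleCat.{u} R)) (n : ℕ) (h : r.P n →ₗ[R] U)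
    (hh : dualMap S U (r.ι n) h = 0) : ∃ h', dualMap S U (r.π n) h' = h := by
  have : Epi (r.π n) := (r.shortExact n).epi_g
  refine ⟨((r.shortExact n).exact.desc (ModuleCat.ofHom h) (ModuleCat.hom_ext hh)).hom, ?_⟩
  exact congrArg ModuleCat.Hom.hom
    ((r.shortExact n).exact.g_desc (ModuleCat.ofHom h) (ModuleCat.hom_ext hh))

lemma dualMap_ι_dualMap_π (r : SyzygySequence (ModuleCat.{u} R)) (n : ℕ) (h : r.Z n →ₗ[R] U) :
    dualMap S U (r.ι n) (dualMap S U (r.π n) h) = 0 := by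
  refine LinearMap.ext fun z => ?_
  have : r.π n (r.ι n z) = 0 := congr($(r.zero n) z)
  change h (r.π n (r.ι n z)) = 0
  rw [this, map_zero]

end Dual

section ToExt

variable {R : Type u} (S U : Type u) [Ring R] [Ring S] [AddCommGroup U] [Module R U] [Module S U]
  [SMulCommClass R S U] [SMulCommClass S R U]

/-- The `S`-linear map `Hom_R(Z n, U) ⟶ Ext^n_R(Z 0, U)` given by the Yoneda class. -/
def toExt (r : SyzygySequence (ModuleCat.{u} R)) (n : ℕ) :
    dual S U (r.Z n) ⟶ (extFunctor R S U n).obj (op (r.Z 0)) :=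
  ModuleCat.ofHom (Y := ExtModule R S U (r.Z 0) n)
    { toFun := fun h => (r.yonedaClass n).comp (Ext.mk₀ (ModuleCat.ofHom h)) (add_zero n)
      map_add' := fun h h' => by
        rw [show ModuleCat.ofHom (h + h') = ModuleCat.ofHom h + ModuleCat.ofHom h' from rfl,
          Ext.mk₀_add, Ext.comp_add]
        rfl
      map_smul' := fun s h => by
        rw [show ModuleCat.ofHom (s • h) = ModuleCat.ofHom h ≫ smulHom R S U s from rfl,
          ← Ext.mk₀_comp_mk₀, ← Ext.comp_assoc_of_third_deg_zero]
        rfl }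

lemma toExt_naturality {r r' : SyzygySequence (ModuleCat.{u} R)} (φ : r.Hom r') (n : ℕ) :
    toExt S U r' n ≫ (extFunctor R S U n).map (φ.z 0).op =
      dualMap S U (φ.z n) ≫ toExt S U r n := by
  ext h
  change (Ext.mk₀ (φ.z 0)).comp ((r'.yonedaClass n).comp (Ext.mk₀ (ModuleCat.ofHom h))
    (add_zero n)) (zero_add n) = (r.yonedaClass n).comp (Ext.mk₀ (φ.z n ≫ ModuleCat.ofHom h))
    (add_zero n)
  rw [← Ext.mk₀_comp_mk₀, ← Ext.comp_assoc_of_third_deg_zero,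
    ← Ext.comp_assoc_of_third_deg_zero, SyzygySequence.yonedaClass_naturality]

variable {r : SyzygySequence (ModuleCat.{u} R)}

lemma toExt_surjective (hP : ∀ i, Projective (r.P i)) (n : ℕ) :
    Function.Surjective (toExt S U r n) := by
  intro y
  obtain ⟨x, hx⟩ := SyzygySequence.yonedaClass_comp_surjective (Y := ModuleCat.of R U)
    (fun i j => Ext.subsingleton_of_projective (r.P i) _ j) n 0 n (add_zero n) y
  obtain ⟨h, rfl⟩ := (Ext.mk₀_bijective _ _).2 x
  exact ⟨h.hom, hx⟩

lemma toExt_eq_zero_iff (hP : ∀ i, Projective (r.P i)) (n : ℕ) (h : r.Z (n + 1) →ₗ[R] U) :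
    toExt S U r (n + 1) h = 0 ↔ ∃ h', dualMap S U (r.ι n) h' = h := by
  refine (SyzygySequence.yonedaClass_comp_mk₀_eq_zero_iff (Y := ModuleCat.of R U)
    (fun i j => Ext.subsingleton_of_projective (r.P i) _ j) n (ModuleCat.ofHom h)).trans ?_
  constructor
  · rintro ⟨h', e⟩
    exact ⟨h'.hom, congrArg ModuleCat.Hom.hom e⟩
  · rintro ⟨h', e⟩
    exact ⟨ModuleCat.ofHom h', ModuleCat.hom_ext e⟩

end ToExt

section DualSplice

variable {R S U : Type u} [Ring R] [Ring S] [AddCommGroup U] [Module R U] [Module S U]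
  [SMulCommClass R S U]

variable (S U) in
/-- The boundaries in `Hom_R(Z (i + 1), U)`: the maps that extend to `P i`. -/
abbrev dualBoundaries (r : SyzygySequence (ModuleCat.{u} R)) (i : ℕ) : ModuleCat.{u} S :=
  ModuleCat.of S (LinearMap.range (dualMap S U (r.ι i)).hom)

variable (S U) in
/-- The inclusion of the boundaries. -/
def dualBoundariesι (r : SyzygySequence (ModuleCat.{u} R)) (i : ℕ) :
    dualBoundaries S U r i ⟶ dual S U (r.Z (i + 1)) :=
  ModuleCat.ofHom (LinearMap.range (dualMap S U (r.ι i)).hom).subtype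

variable (S U) in
/-- The surjection from `Hom_R(P i, U)` to the boundaries. -/
def toDualBoundaries (r : SyzygySequence (ModuleCat.{u} R)) (i : ℕ) :
    dual S U (r.P i) ⟶ dualBoundaries S U r i :=
  ModuleCat.ofHom (dualMap S U (r.ι i)).hom.rangeRestrict

lemma dualBoundariesι_injective (r : SyzygySequence (ModuleCat.{u} R)) (i : ℕ) :
    Function.Injective (dualBoundariesι S U r i) := Subtype.val_injective

lemma toDualBoundaries_surjective (r : SyzygySequence (ModuleCat.{u} R)) (i : ℕ) :
    Function.Surjective (toDualBoundaries S U r i) :=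
  (dualMap S U (r.ι i)).hom.surjective_rangeRestrict

lemma toDualBoundaries_eq_zero_iff (r : SyzygySequence (ModuleCat.{u} R)) (i : ℕ)
    (h : r.P i →ₗ[R] U) : toDualBoundaries S U r i h = 0 ↔ dualMap S U (r.ι i) h = 0 :=
  Subtype.ext_iff

lemma dualBoundaries_zero (r : SyzygySequence (ModuleCat.{u} R)) (i : ℕ) :
    dualMap S U (r.π i) ≫ toDualBoundaries S U r i = 0 :=
  ModuleCat.hom_ext (LinearMap.ext fun h =>
    (toDualBoundaries_eq_zero_iff r i _).2 (dualMap_ι_dualMap_π S U r i h))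

lemma dualBoundaries_shortExact (r : SyzygySequence (ModuleCat.{u} R)) (i : ℕ) :
    (ShortComplex.mk _ _ (dualBoundaries_zero (S := S) (U := U) r i)).ShortExact :=
  moduleCat_shortExact _ (dualMap_π_injective S U r i)
    (fun x hx => exists_dualMap_π_eq S U r i x ((toDualBoundaries_eq_zero_iff r i x).1 hx))
    (toDualBoundaries_surjective r i)

/-- The data that make the dual of the first terms of a syzygy sequence an exact sequence
`0 ⟶ B ⟶ Hom_R(P 1, U) ⟶ ⋯ ⟶ Hom_R(P k, U) ⟶ Hom_R(Z (k + 1), U) ⟶ E ⟶ 0`. -/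
structure DualSplice (r : SyzygySequence (ModuleCat.{u} R)) (k : ℕ) (E B : ModuleCat.{u} S) where
  q : dual S U (r.Z (k + 1)) ⟶ E
  γ : B ⟶ dual S U (r.Z 1)
  q_surjective : Function.Surjective q
  q_eq_zero_iff : ∀ h, q h = 0 ↔ ∃ h', dualMap S U (r.ι k) h' = h
  γ_injective : Function.Injective γ
  exists_γ_eq_iff : ∀ h, (∃ b, γ b = h) ↔ ∃ h', dualMap S U (r.ι 0) h' = h
  exists_extension : ∀ i < k, ∀ h : dual S U (r.Z (i + 1)), ∃ h', dualMap S U (r.ι i) h' = h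

namespace DualSplice

variable {r r' : SyzygySequence (ModuleCat.{u} R)} {k : ℕ} {E B E' B' : ModuleCat.{u} S}

/-- The part of the dual sequence that comes from the tail. -/
def tail (d : DualSplice (U := U) r (k + 1) E B) :
    DualSplice (U := U) r.tail k E (dualBoundaries S U r 1) where
  q := d.q
  γ := dualBoundariesι S U r 1
  q_surjective := d.q_surjective
  q_eq_zero_iff := d.q_eq_zero_iff
  γ_injective := dualBoundariesι_injective r 1
  exists_γ_eq_iff h := ⟨fun ⟨b, hb⟩ => hb ▸ b.2, fun hh => ⟨⟨h, hh⟩, rfl⟩⟩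
  exists_extension i hi h := d.exists_extension (i + 1) (by lia) h

lemma γ_q (d : DualSplice (U := U) r 0 E B) : d.γ ≫ d.q = 0 := by
  ext b
  exact (d.q_eq_zero_iff _).2 ((d.exists_γ_eq_iff _).1 ⟨b, rfl⟩)

lemma shortExact_γ_q (d : DualSplice (U := U) r 0 E B) :
    (ShortComplex.mk _ _ d.γ_q).ShortExact :=
  moduleCat_shortExact _ d.γ_injective
    (fun x hx => (d.exists_γ_eq_iff x).2 ((d.q_eq_zero_iff x).1 hx)) d.q_surjective

lemma γ_dualMap_zero (d : DualSplice (U := U) r (k + 1) E B) :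
    (d.γ ≫ dualMap S U (r.π 1)) ≫ toDualBoundaries S U r 1 = 0 := by
  rw [Category.assoc, dualBoundaries_zero, Limits.comp_zero]

lemma shortExact_γ_dualMap (d : DualSplice (U := U) r (k + 1) E B) :
    (ShortComplex.mk _ _ d.γ_dualMap_zero).ShortExact := by
  refine moduleCat_shortExact _ ((dualMap_π_injective S U r 1).comp d.γ_injective) ?_
    (toDualBoundaries_surjective r 1)
  intro x hx
  obtain ⟨h, rfl⟩ := exists_dualMap_π_eq S U r 1 x ((toDualBoundaries_eq_zero_iff r 1 x).1 hx)
  obtain ⟨b, rfl⟩ := (d.exists_γ_eq_iff h).2 (d.exists_extension 0 (by lia) h)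
  exact ⟨b, rfl⟩

/-- The Yoneda class in `Ext^(k+1)_S(E, B)` of the dual sequence. -/
def yonedaClass : ∀ {k : ℕ} {r : SyzygySequence (ModuleCat.{u} R)} {B : ModuleCat.{u} S},
    DualSplice (U := U) r k E B → Ext E B (k + 1)
  | 0, _, _, d => d.shortExact_γ_q.extClass
  | _ + 1, _, _, d => d.tail.yonedaClass.comp d.shortExact_γ_dualMap.extClass rfl

lemma yonedaClass_naturality (d : DualSplice (U := U) r k E B)
    (d' : DualSplice (U := U) r' k E' B') (φ : r.Hom r') (ε : E' ⟶ E) (b : B' ⟶ B)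
    (hε : d'.q ≫ ε = dualMap S U (φ.z (k + 1)) ≫ d.q)
    (hb : b ≫ d.γ = d'.γ ≫ dualMap S U (φ.z 1)) :
    (Ext.mk₀ ε).comp d.yonedaClass (zero_add _) =
      d'.yonedaClass.comp (Ext.mk₀ b) (add_zero _) := by
  induction k generalizing r r' B B' with
  | zero =>
    exact (d'.shortExact_γ_q.extClass_naturality d.shortExact_γ_q
      ⟨b, dualMap S U (φ.z 1), ε, hb, hε.symm⟩).symm
  | succ k ih =>
    have hβ : ∀ x : dualBoundaries S U r' 1, dualMap S U (φ.z 2) (dualBoundariesι S U r' 1 x) ∈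
        LinearMap.range (dualMap S U (r.ι 1)).hom := by
      rintro ⟨_, h, rfl⟩
      refine ⟨dualMap S U (φ.p 1) h, ?_⟩
      exact congr(dualMap S U $(φ.ι_comm 1) h).symm
    let β : dualBoundaries S U r' 1 ⟶ dualBoundaries S U r 1 := ModuleCat.ofHom
      (LinearMap.codRestrict _ (dualBoundariesι S U r' 1 ≫ dualMap S U (φ.z 2)).hom hβ)
    have h₁ := ih d.tail d'.tail φ.tail β hε rfl
    have h₂ := d'.shortExact_γ_dualMap.extClass_naturality d.shortExact_γ_dualMap
      ⟨b, dualMap S U (φ.p 1), β, by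
        dsimp only
        rw [← Category.assoc, hb, Category.assoc, Category.assoc, ← dualMap_comp,
          ← dualMap_comp, φ.π_comm], by
        exact ModuleCat.hom_ext (LinearMap.ext fun h => Subtype.ext
          congr(dualMap S U $(φ.ι_comm 1) h).symm)⟩
    dsimp only at h₂
    dsimp only [yonedaClass]
    rw [← Ext.comp_assoc _ _ _ (zero_add _) rfl (by lia), h₁,
      Ext.comp_assoc_of_second_deg_zero, Ext.comp_assoc_of_third_deg_zero]
    erw [h₂]

/-- The modules in the dual sequence are acyclic for `Hom_S(-, U)`. -/
structure Acyclic (r : SyzygySequence (ModuleCat.{u} R)) (k : ℕ) : Prop where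
  ext_P : ∀ i j, Subsingleton (Ext (dual S U (r.P i)) (ModuleCat.of S U) (j + 1))
  ext_Z : ∀ j, Subsingleton (Ext (dual S U (r.Z (k + 1))) (ModuleCat.of S U) (j + 1))

lemma Acyclic.tail (h : Acyclic (S := S) (U := U) r (k + 1)) :
    Acyclic (S := S) (U := U) r.tail k :=
  ⟨fun i => h.ext_P (i + 1), h.ext_Z⟩

lemma yonedaClass_comp_surjective (d : DualSplice (U := U) r k E B)
    (h : Acyclic (S := S) (U := U) r k) (j n : ℕ) (hn : k + 1 + j = n)
    (y : Ext E (ModuleCat.of S U) n) :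
    ∃ x : Ext B (ModuleCat.of S U) j, d.yonedaClass.comp x hn = y := by
  induction k generalizing r B j with
  | zero =>
    obtain rfl : n = j + 1 := by lia
    exact Ext.contravariant_sequence_exact₃ d.shortExact_γ_q _ y
      (Subsingleton.elim (h := h.ext_Z j) _ _) _
  | succ k ih =>
    obtain ⟨x', rfl⟩ := ih d.tail h.tail (j + 1) (by lia)
    obtain ⟨x, rfl⟩ := Ext.contravariant_sequence_exact₃ d.shortExact_γ_dualMap _ x'
      (Subsingleton.elim (h := h.ext_P 1 j) _ _) (add_comm 1 j)
    exact ⟨x, Ext.comp_assoc _ _ _ rfl _ (by lia)⟩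

lemma eq_zero_of_yonedaClass_comp_eq_zero (d : DualSplice (U := U) r k E B)
    (h : Acyclic (S := S) (U := U) r k) (j n : ℕ) (hn : k + 1 + (j + 1) = n)
    (x : Ext B (ModuleCat.of S U) (j + 1)) (hx : d.yonedaClass.comp x hn = 0) : x = 0 := by
  induction k generalizing r B j with
  | zero =>
    obtain ⟨x₂, rfl⟩ := Ext.contravariant_sequence_exact₁ d.shortExact_γ_q _ x _ hx
    rw [Subsingleton.elim (h := h.ext_Z j) x₂ 0, Ext.comp_zero]
  | succ k ih =>
    dsimp only [yonedaClass] at hx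
    rw [Ext.comp_assoc _ _ _ rfl (add_comm 1 (j + 1)) (by lia)] at hx
    obtain ⟨x₂, rfl⟩ := Ext.contravariant_sequence_exact₁ d.shortExact_γ_dualMap _ x _
      (ih d.tail h.tail (j + 1) (by lia) _ hx)
    rw [Subsingleton.elim (h := h.ext_P 1 j) x₂ 0, Ext.comp_zero]

lemma yonedaClass_comp_mk₀_eq_zero_iff (d : DualSplice (U := U) r k E B)
    (h : Acyclic (S := S) (U := U) r k) (hP : ∀ i, EvalSurjective S U (r.P i))
    (hZ : EvalSurjective S U (r.Z (k + 1))) (f : B ⟶ ModuleCat.of S U) :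
    d.yonedaClass.comp (Ext.mk₀ f) (add_zero _) = 0 ↔
      ∃ z : r.Z 1, f = d.γ ≫ evalAt S U z := by
  cases k with
  | zero =>
    refine (extClass_comp_mk₀_eq_zero_iff d.shortExact_γ_q f).trans ⟨?_, ?_⟩
    · rintro ⟨f', rfl⟩
      obtain ⟨z, rfl⟩ := hZ f'
      exact ⟨z, rfl⟩
    · rintro ⟨z, rfl⟩
      exact ⟨_, rfl⟩
  | succ k =>
    dsimp only [yonedaClass]
    rw [Ext.comp_assoc _ _ _ rfl (add_zero 1) (by lia)]
    constructor
    · intro hx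
      obtain ⟨f', rfl⟩ := (extClass_comp_mk₀_eq_zero_iff d.shortExact_γ_dualMap f).1
        (eq_zero_of_yonedaClass_comp_eq_zero d.tail h.tail 0 _ rfl _ hx)
      obtain ⟨p, rfl⟩ := hP 1 f'
      exact ⟨r.π 1 p, rfl⟩
    · rintro ⟨z, rfl⟩
      obtain ⟨p, rfl⟩ := (ModuleCat.epi_iff_surjective (r.π 1)).1 (r.shortExact 1).epi_g z
      have := (extClass_comp_mk₀_eq_zero_iff d.shortExact_γ_dualMap
        (d.γ ≫ evalAt S U (r.π 1 p))).2 ⟨evalAt S U p, rfl⟩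
      rw [this, Ext.comp_zero]

end DualSplice

end DualSplice

section FreeResolution

variable {R : Type u} [Ring R]

/-- The number of generators used in `freeCover`. -/
def freeCoverRank (M : ModuleCat.{u} R) [Module.Finite R M] : ℕ :=
  (Module.Finite.exists_fin' R M).choose

/-- A surjection onto a finitely generated module from a finite free module. -/
def freeCover (M : ModuleCat.{u} R) [Module.Finite R M] :
    ModuleCat.of R (Fin (freeCoverRank M) → R) ⟶ M :=
  ModuleCat.ofHom (Module.Finite.exists_fin' R M).choose_spec.choose

lemma freeCover_surjective (M : ModuleCat.{u} R) [Module.Finite R M] :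
    Function.Surjective (freeCover M) :=
  (Module.Finite.exists_fin' R M).choose_spec.choose_spec

variable [IsNoetherianRing R]

/-- The `n`-th syzygy of a finitely generated module. -/
def syzygy (M : {M : ModuleCat.{u} R // Module.Finite R M}) :
    ℕ → {M : ModuleCat.{u} R // Module.Finite R M}
  | 0 => M
  | n + 1 =>
    have := (syzygy M n).2
    ⟨ModuleCat.of R (LinearMap.ker (freeCover (syzygy M n).1).hom), inferInstance⟩

instance (M : {M : ModuleCat.{u} R // Module.Finite R M}) (n : ℕ) :
    Module.Finite R (syzygy M n).1 := (syzygy M n).2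

/-- A resolution of a finitely generated module by finite free modules. -/
def freeResolution (M : {M : ModuleCat.{u} R // Module.Finite R M}) :
    SyzygySequence (ModuleCat.{u} R) where
  Z n := (syzygy M n).1
  P n := ModuleCat.of R (Fin (freeCoverRank (syzygy M n).1) → R)
  ι n := ModuleCat.ofHom (LinearMap.ker (freeCover (syzygy M n).1).hom).subtype
  π n := freeCover (syzygy M n).1
  zero _ := ModuleCat.hom_ext (LinearMap.ext fun x => x.2)
  shortExact _ := moduleCat_shortExact _ Subtype.val_injective (fun x hx => ⟨⟨x, hx⟩, rfl⟩)
    (freeCover_surjective _)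

end FreeResolution

/-- All the modules `P i` are finite free and all the syzygies are finitely generated. -/
structure SyzygySequence.IsFiniteFree {R : Type u} [Ring R]
    (r : SyzygySequence (ModuleCat.{u} R)) : Prop where
  free : ∀ i, Module.Free R (r.P i)
  finite_P : ∀ i, Module.Finite R (r.P i)
  finite_Z : ∀ i, Module.Finite R (r.Z i)

lemma freeResolution_isFiniteFree {R : Type u} [Ring R] [IsNoetherianRing R]
    (M : {M : ModuleCat.{u} R // Module.Finite R M}) : (freeResolution M).IsFiniteFree where
  free _ := inferInstanceAs (Module.Free R (Fin _ → R))
  finite_P _ := inferInstanceAs (Module.Finite R (Fin _ → R))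
  finite_Z i := (syzygy M i).2

lemma SyzygySequence.IsFiniteFree.projective {R : Type u} [Ring R]
    {r : SyzygySequence (ModuleCat.{u} R)} (hr : r.IsFiniteFree) (i : ℕ) :
    Projective (r.P i) := by
  have := hr.free i
  exact (r.P i).projective_of_categoryTheory_projective

section FreeDual

variable {R S U : Type u} [Ring R] [Ring S] [AddCommGroup U] [Module R U] [Module S U]
  [SMulCommClass R S U]

/-- The map `U ⟶ Hom_R(P, U)` sending `u` to `x ↦ xᵢ u`, where `xᵢ` is a coordinate of `x`. -/
def coordDual {P : ModuleCat.{u} R} {I : Type*} (b : Module.Basis I R P) (i : I) :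
    ModuleCat.of S U ⟶ dual S U P :=
  ModuleCat.ofHom
    { toFun := fun x => LinearMap.toSpanSingleton R U x ∘ₗ b.coord i
      map_add' := fun _ _ => LinearMap.ext fun _ => smul_add _ _ _
      map_smul' := fun _ _ => LinearMap.ext fun _ => smul_comm _ _ _ }

lemma sum_evalAt_coordDual {P : ModuleCat.{u} R} {I : Type*} [Fintype I]
    (b : Module.Basis I R P) :
    ∑ i, evalAt S U (b i) ≫ coordDual b i = 𝟙 (dual S U P) := by
  refine ModuleCat.hom_ext (LinearMap.ext fun h => ?_)
  rw [ModuleCat.hom_sum, LinearMap.sum_apply]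
  refine LinearMap.ext fun p => ?_
  rw [LinearMap.sum_apply]
  change ∑ i, b.repr p i • h (b i) = h p
  conv_rhs => rw [← b.sum_repr p, map_sum]
  simp only [map_smul]

variable (S U) in
lemma subsingleton_ext_dual_of_free (P : ModuleCat.{u} R) [Module.Free R P] [Module.Finite R P]
    {n : ℕ} (h : Subsingleton (Ext (ModuleCat.of S U) (ModuleCat.of S U) n)) :
    Subsingleton (Ext (dual S U P) (ModuleCat.of S U) n) := by
  refine subsingleton_of_forall_eq 0 fun x => ?_
  rw [← Ext.mk₀_id_comp x, ← sum_evalAt_coordDual (Module.Free.chooseBasis R P), Ext.mk₀_sum,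
    Ext.sum_comp]
  refine Finset.sum_eq_zero fun i _ => ?_
  rw [← Ext.mk₀_comp_mk₀_assoc, Subsingleton.elim (h := h) (Ext.comp _ x _) 0, Ext.comp_zero]

lemma finite_dual [IsNoetherianRing S] [Module.Finite S U] (M : ModuleCat.{u} R)
    [Module.Finite R M] : Module.Finite S (dual S U M) := by
  obtain ⟨n, f, hf⟩ := Module.Finite.exists_fin' R M
  let e : dual S U M →ₗ[S] (Fin n → U) :=
    { toFun := fun h i => h (f (Pi.single i 1))
      map_add' := fun _ _ => rfl
      map_smul' := fun _ _ => rfl }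
  refine Module.Finite.of_injective e fun h h' hh => ?_
  refine LinearMap.ext fun m => ?_
  obtain ⟨x, rfl⟩ := hf m
  have : h ∘ₗ f = h' ∘ₗ f := (Pi.basisFun R (Fin n)).ext fun i => by
    simpa [e] using congrFun hh i
  exact LinearMap.congr_fun this x

variable (S U) in
lemma evalSurjective_of_free
    (hbal : Function.Surjective (Module.toModuleEnd S U : R →+* Module.End S U))
    (P : ModuleCat.{u} R) [Module.Free R P] [Module.Finite R P] : EvalSurjective S U P := by
  intro ψ
  let b := Module.Free.chooseBasis R P
  choose c hc using fun i => hbal (coordDual b i ≫ ψ).hom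
  refine ⟨∑ i, c i • b i, ModuleCat.hom_ext (LinearMap.ext fun h => ?_)⟩
  have h₁ : h = ∑ i, coordDual b i (h (b i)) := by
    have := congr(($(sum_evalAt_coordDual (S := S) (U := U) b)).hom h)
    rw [ModuleCat.hom_sum, LinearMap.sum_apply] at this
    exact this.symm
  have h₂ : ψ.hom h = ∑ i, ψ.hom (coordDual b i (h (b i))) := by
    rw [← map_sum]
    exact congrArg ψ.hom h₁
  rw [h₂]
  change h (∑ i, c i • b i) = _
  rw [map_sum]
  refine Finset.sum_congr rfl fun i _ => ?_
  rw [map_smul]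
  exact LinearMap.congr_fun (hc i) (h (b i))

variable (S U) in
lemma eq_zero_of_free
    (hbal : Function.Injective (Module.toModuleEnd S U : R →+* Module.End S U))
    (P : ModuleCat.{u} R) [Module.Free R P] (p : P) (hp : ∀ h : P →ₗ[R] U, h p = 0) : p = 0 := by
  let b := Module.Free.chooseBasis R P
  refine b.ext_elem fun i => hbal (LinearMap.ext fun x => ?_)
  rw [map_zero b.repr, Finsupp.zero_apply, map_zero]
  exact hp (coordDual (S := S) b i x)

end FreeDual

section Gorenstein

variable {R S U : Type u} [Ring R] [Ring S] [AddCommGroup U] [Module R U] [Module S U]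
  [SMulCommClass S R U]

lemma subsingleton_ext_of_iso {A B Y : ModuleCat.{u} S} (e : A ≅ B) {n : ℕ}
    (h : Subsingleton (Ext A Y n)) : Subsingleton (Ext B Y n) :=
  subsingleton_of_forall_eq 0 fun x => by
    rw [← Ext.mk₀_id_comp x, ← e.inv_hom_id, ← Ext.mk₀_comp_mk₀_assoc,
      Subsingleton.elim (h := h) (Ext.comp _ x _) 0, Ext.comp_zero]

lemma IsGorenstein.gradeGE_ext (h : IsGorenstein S R U) (M : ModuleCat.{u} R)
    [hM : Module.Finite R M] (i : ℕ) : GradeGE S U ((extFunctor R S U i).obj (op M)) i := by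
  intro j hj
  exact subsingleton_ext_of_iso (LinearEquiv.toModuleIso Submodule.topEquiv)
    (h i (by lia) M hM i (by lia) le_rfl ⊤ j hj)

end Gorenstein

section Hypotheses

variable (R S U : Type u) [Ring R] [Ring S] [AddCommGroup U] [Module R U] [Module S U]
  [SMulCommClass R S U] [SMulCommClass S R U]

/-- The conditions on `U` as an `S`-module that make `Ext^g_S(Ext^g_R(M, U), U)` isomorphic to `M`
for the `R`-modules `M` of grade at least `g`. -/
structure IsDualizing (g : ℕ) : Prop where
  balanced : Function.Bijective (Module.toModuleEnd S U : R →+* Module.End S U)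
  selforthogonal : ∀ j, Subsingleton (Ext (ModuleCat.of S U) (ModuleCat.of S U) (j + 1))
  gorenstein : IsGorenstein S R U
  injectiveDimension_le : HasInjectiveDimensionLE (ModuleCat.of S U) g

variable {R S U}

variable {g : ℕ} {r : SyzygySequence (ModuleCat.{u} R)}

namespace IsDualizing

lemma subsingleton_ext_ext (H : IsDualizing R S U g) (M : ModuleCat.{u} R) [Module.Finite R M]
    {i : ℕ} (hi : g < i) (j : ℕ) :
    Subsingleton (Ext ((extFunctor R S U i).obj (op M)) (ModuleCat.of S U) j) := by
  obtain hj | hj := lt_or_ge j i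
  · exact H.gorenstein.gradeGE_ext M i j hj
  · have := H.injectiveDimension_le
    exact HasInjectiveDimensionLT.subsingleton _ (g + 1) j (by lia) _

end IsDualizing

lemma dualBoundariesι_toExt (hP : ∀ i, Projective (r.P i)) (m : ℕ) :
    dualBoundariesι S U r m ≫ toExt S U r (m + 1) = 0 :=
  ModuleCat.hom_ext (LinearMap.ext fun x => (toExt_eq_zero_iff S U hP m _).2 x.2)

lemma toExt_shortExact (hP : ∀ i, Projective (r.P i)) (m : ℕ) :
    (ShortComplex.mk _ _ (dualBoundariesι_toExt (S := S) (U := U) hP m)).ShortExact :=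
  moduleCat_shortExact _ (dualBoundariesι_injective r m)
    (fun x hx => ⟨⟨x, (toExt_eq_zero_iff S U hP m x).1 hx⟩, rfl⟩) (toExt_surjective S U hP _)

lemma exists_extension_of_subsingleton_ext {C : Type*} [Category* C] [Abelian C] [HasExt.{u} C]
    {T : ShortComplex C} (hT : T.ShortExact) {Y : C} (h : Subsingleton (Ext T.X₃ Y 1))
    (f : T.X₁ ⟶ Y) : ∃ f', T.f ≫ f' = f :=
  (extClass_comp_mk₀_eq_zero_iff hT f).1 (Subsingleton.elim (h := h) _ _)

namespace IsDualizing

lemma subsingleton_ext_dualBoundaries (H : IsDualizing R S U g) (hr : r.IsFiniteFree)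
    {m : ℕ} (hm : g ≤ m) (i : ℕ)
    (h : Subsingleton (Ext (dual S U (r.Z (m + 1))) (ModuleCat.of S U) i)) :
    Subsingleton (Ext (dualBoundaries S U r m) (ModuleCat.of S U) i) := by
  have := hr.finite_Z 0
  refine subsingleton_of_forall_eq 0 fun x => ?_
  obtain ⟨y, rfl⟩ := Ext.contravariant_sequence_exact₁ (toExt_shortExact hr.projective m) _ x rfl
    (Subsingleton.elim (h := H.subsingleton_ext_ext (r.Z 0) (by lia) _) _ _)
  rw [Subsingleton.elim (h := h) y 0, Ext.comp_zero]

lemma subsingleton_ext_dual_P (H : IsDualizing R S U g) (hr : r.IsFiniteFree) (i j : ℕ) :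
    Subsingleton (Ext (dual S U (r.P i)) (ModuleCat.of S U) (j + 1)) := by
  have := hr.free i
  have := hr.finite_P i
  exact subsingleton_ext_dual_of_free S U (r.P i) (H.selforthogonal j)

lemma subsingleton_ext_dual_Z (H : IsDualizing R S U g) (hr : r.IsFiniteFree)
    {m : ℕ} (hm : g ≤ m) (j : ℕ) :
    Subsingleton (Ext (dual S U (r.Z m)) (ModuleCat.of S U) (j + 1)) := by
  suffices ∀ k m j, g ≤ m → g ≤ j + k →
      Subsingleton (Ext (dual S U (r.Z m)) (ModuleCat.of S U) (j + 1)) from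
    this g m j hm (by lia)
  intro k
  induction k with
  | zero =>
    intro m j _ hj
    have := H.injectiveDimension_le
    exact HasInjectiveDimensionLT.subsingleton _ (g + 1) (j + 1) (by lia) _
  | succ k ih =>
    intro m j hm hj
    refine subsingleton_of_forall_eq 0 fun x => ?_
    have h := H.subsingleton_ext_dualBoundaries hr hm (j + 2) (ih (m + 1) (j + 1) (by lia) (by lia))
    obtain ⟨y, rfl⟩ := Ext.contravariant_sequence_exact₁ (dualBoundaries_shortExact r m) _ x
      (by lia : 1 + (j + 1) = j + 2) (Subsingleton.elim (h := h) _ _)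
    rw [Subsingleton.elim (h := H.subsingleton_ext_dual_P hr m j) y 0, Ext.comp_zero]

lemma evalSurjective_P (H : IsDualizing R S U g) (hr : r.IsFiniteFree) (i : ℕ) :
    EvalSurjective S U (r.P i) := by
  have := hr.free i
  have := hr.finite_P i
  exact evalSurjective_of_free S U H.balanced.2 (r.P i)

lemma evalSurjective_Z (H : IsDualizing R S U g) (hr : r.IsFiniteFree) {m : ℕ} (hm : g ≤ m) :
    EvalSurjective S U (r.Z m) := by
  intro ψ
  obtain ⟨ψ', rfl⟩ := exists_extension_of_subsingleton_ext (dualBoundaries_shortExact r m)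
    (H.subsingleton_ext_dualBoundaries hr hm 1 (H.subsingleton_ext_dual_Z hr (by lia) 0)) ψ
  obtain ⟨p, rfl⟩ := H.evalSurjective_P hr m ψ'
  exact ⟨r.π m p, rfl⟩

lemma eq_of_evalAt_eq_P (H : IsDualizing R S U g) (hr : r.IsFiniteFree) {i : ℕ} {p p' : r.P i}
    (h : evalAt S U p = evalAt S U p') : p = p' := by
  have := hr.free i
  refine sub_eq_zero.1 (eq_zero_of_free S U H.balanced.1 (r.P i) _ fun f => ?_)
  rw [map_sub, sub_eq_zero]
  exact congr($h f)

lemma eq_zero_of_evalAt_eq_zero_Z (H : IsDualizing R S U g) (hr : r.IsFiniteFree) {m : ℕ}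
    (hm : g ≤ m) (z : r.Z m) (hz : evalAt S U z = 0) : z = 0 := by
  have hfin := hr.finite_Z 0
  obtain ⟨p, rfl⟩ := (ModuleCat.epi_iff_surjective (r.π m)).1 (r.shortExact m).epi_g z
  have hT := dualBoundaries_shortExact (S := S) (U := U) r m
  have := hT.epi_g
  obtain ⟨χ, hχ⟩ : ∃ χ, toDualBoundaries S U r m ≫ χ = evalAt S U p :=
    ⟨hT.exact.desc (evalAt S U p) hz, hT.exact.g_desc _ _⟩
  obtain ⟨χ', rfl⟩ := exists_extension_of_subsingleton_ext (toExt_shortExact hr.projective m)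
    (H.subsingleton_ext_ext (r.Z 0) (by lia) 1) χ
  obtain ⟨y, rfl⟩ := H.evalSurjective_Z hr (by lia : g ≤ m + 1) χ'
  have hp : r.ι m y = p := H.eq_of_evalAt_eq_P hr hχ
  rw [← hp]
  exact congr($(r.zero m) y)

end IsDualizing

end Hypotheses

section Bidual

variable {R S U : Type u} [Ring R] [Ring S] [AddCommGroup U] [Module R U] [Module S U]
  [SMulCommClass R S U]

/-- A class `x` in `Ext^n_S(E, Hom_R(P, U))` induces the `R`-linear map `P ⟶ Ext^n_S(E, U)` that
sends `p` to the composition of `x` with the evaluation at `p`. -/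
def compEval {E : ModuleCat.{u} S} {P : ModuleCat.{u} R} {n : ℕ} (x : Ext E (dual S U P) n) :
    P ⟶ (extFunctor S R U n).obj (op E) :=
  ModuleCat.ofHom (Y := ExtModule S R U E n)
    { toFun := fun p => x.comp (Ext.mk₀ (evalAt S U p)) (add_zero n)
      map_add' := fun p p' => by
        rw [show evalAt S U (p + p') = evalAt S U p + evalAt S U p' from
          ModuleCat.hom_ext (LinearMap.ext fun h => map_add (show P →ₗ[R] U from h) p p'),
          Ext.mk₀_add, Ext.comp_add]
        rfl
      map_smul' := fun c p => by
        rw [show evalAt S U (c • p) = evalAt S U p ≫ smulHom S R U c from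
          ModuleCat.hom_ext (LinearMap.ext fun h => map_smul (show P →ₗ[R] U from h) c p),
          ← Ext.mk₀_comp_mk₀, ← Ext.comp_assoc_of_third_deg_zero]
        rfl }

lemma compEval_naturality {E E' : ModuleCat.{u} S} {P P' : ModuleCat.{u} R} {n : ℕ}
    (x : Ext E (dual S U P) n) (x' : Ext E' (dual S U P') n) (ε : E' ⟶ E) (f : P ⟶ P')
    (h : (Ext.mk₀ ε).comp x (zero_add n) = x'.comp (Ext.mk₀ (dualMap S U f)) (add_zero n)) :
    compEval x ≫ (extFunctor S R U n).map ε.op = f ≫ compEval x' := by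
  ext p
  change (Ext.mk₀ ε).comp (x.comp (Ext.mk₀ (evalAt S U p)) (add_zero n)) (zero_add n) =
    x'.comp (Ext.mk₀ (dualMap S U f ≫ evalAt S U p)) (add_zero n)
  rw [← Ext.comp_assoc_of_third_deg_zero, h, Ext.comp_assoc_of_third_deg_zero, Ext.mk₀_comp_mk₀]

variable [SMulCommClass S R U] {g : ℕ} {r : SyzygySequence (ModuleCat.{u} R)}

variable (S) in
/-- The dual of a resolution of a module of grade at least `k + 1` is exact up to degree `k`, and
continues to `Ext^(k+1)_R(Z 0, U)`. -/
def gradeSplice (hP : ∀ i, Projective (r.P i)) {k : ℕ} (hM : GradeGE R U (r.Z 0) (k + 1)) :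
    DualSplice (U := U) r k ((extFunctor R S U (k + 1)).obj (op (r.Z 0))) (dual S U (r.P 0)) where
  q := toExt S U r (k + 1)
  γ := dualMap S U (r.ι 0)
  q_surjective := toExt_surjective S U hP _
  q_eq_zero_iff := toExt_eq_zero_iff S U hP k
  γ_injective := by
    refine (injective_iff_map_eq_zero (dualMap S U (r.ι 0)).hom).2 fun h hh => ?_
    obtain ⟨h', rfl⟩ := exists_dualMap_π_eq S U r 0 h hh
    have : ModuleCat.ofHom h' = 0 := (Ext.mk₀_bijective _ _).1
      (Subsingleton.elim (h := hM 0 (by lia)) _ _)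
    rw [show h' = 0 from congrArg ModuleCat.Hom.hom this]
    exact map_zero (dualMap S U (r.π 0)).hom
  exists_γ_eq_iff _ := Iff.rfl
  exists_extension i hi h := (toExt_eq_zero_iff S U hP i h).1
    (Subsingleton.elim (h := hM (i + 1) (by lia)) _ _)

lemma toExt_zero_injective (r : SyzygySequence (ModuleCat.{u} R)) :
    Function.Injective (toExt S U r 0) := by
  intro h h' e
  have e' : (Ext.mk₀ (𝟙 (r.Z 0))).comp (Ext.mk₀ (ModuleCat.ofHom h)) (add_zero 0) =
    (Ext.mk₀ (𝟙 (r.Z 0))).comp (Ext.mk₀ (ModuleCat.ofHom h')) (add_zero 0) := e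
  rw [Ext.mk₀_id_comp, Ext.mk₀_id_comp] at e'
  exact congrArg ModuleCat.Hom.hom ((Ext.mk₀_bijective _ _).1 e')

lemma isIso_toExt_zero (hP : ∀ i, Projective (r.P i)) : IsIso (toExt S U r 0) :=
  (ConcreteCategory.isIso_iff_bijective _).2 ⟨toExt_zero_injective r, toExt_surjective S U hP 0⟩

lemma inv_toExt_zero_naturality {r r' : SyzygySequence (ModuleCat.{u} R)} (φ : r.Hom r')
    [IsIso (toExt S U r 0)] [IsIso (toExt S U r' 0)] :
    (extFunctor R S U 0).map (φ.z 0).op ≫ inv (toExt S U r 0) =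
      inv (toExt S U r' 0) ≫ dualMap S U (φ.z 0) := by
  rw [IsIso.comp_inv_eq, Category.assoc, IsIso.eq_inv_comp, toExt_naturality]

variable (R S U) in
/-- A functorial presentation of the finitely generated `R`-modules of grade at least `g`, by
modules `P M` with classes in `Ext^g_S(Ext^g_R(M, U), Hom_R(P M, U))`, such that `compEval`
identifies `M` with `Ext^g_S(Ext^g_R(M, U), U)`. -/
structure BidualPresentation (g : ℕ) where
  P : ∀ M : ModuleCat.{u} R, Module.Finite R M → GradeGE R U M g → ModuleCat.{u} R
  π : ∀ M hM hg, P M hM hg ⟶ M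
  x : ∀ M hM hg, Ext ((extFunctor R S U g).obj (op M)) (dual S U (P M hM hg)) g
  π_surjective : ∀ M hM hg, Function.Surjective (π M hM hg)
  compEval_surjective : ∀ M hM hg, Function.Surjective (compEval (x M hM hg))
  compEval_eq_zero_iff : ∀ M hM hg p, compEval (x M hM hg) p = 0 ↔ π M hM hg p = 0
  exists_lift : ∀ M hM hg M' hM' hg' (f : M ⟶ M'), ∃ f' : P M hM hg ⟶ P M' hM' hg',
    f' ≫ π M' hM' hg' = π M hM hg ≫ f ∧
      (Ext.mk₀ ((extFunctor R S U g).map f.op)).comp (x M hM hg) (zero_add g) =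
        (x M' hM' hg').comp (Ext.mk₀ (dualMap S U f')) (add_zero g)

lemma BidualPresentation.exists_hom (p : BidualPresentation R S U g) (M : ModuleCat.{u} R)
    (hM : Module.Finite R M) (hg : GradeGE R U M g) :
    ∃ e : M ≅ (extFunctor S R U g).obj (op ((extFunctor R S U g).obj (op M))),
      p.π M hM hg ≫ e.hom = compEval (p.x M hM hg) := by
  have hker : LinearMap.ker (p.π M hM hg).hom = LinearMap.ker (compEval (p.x M hM hg)).hom :=
    Submodule.ext fun y => (p.compEval_eq_zero_iff M hM hg y).symm
  let e := ((p.π M hM hg).hom.quotKerEquivOfSurjective (p.π_surjective M hM hg)).symm ≪≫ₗ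
    Submodule.quotEquivOfEq _ _ hker ≪≫ₗ
    (compEval (p.x M hM hg)).hom.quotKerEquivOfSurjective (p.compEval_surjective M hM hg)
  refine ⟨e.toModuleIso, ModuleCat.hom_ext (LinearMap.ext fun y => ?_)⟩
  have h : ((p.π M hM hg).hom.quotKerEquivOfSurjective (p.π_surjective M hM hg)).symm
      (p.π M hM hg y) = Submodule.Quotient.mk y := by
    rw [LinearEquiv.symm_apply_eq]
    rfl
  change e (p.π M hM hg y) = _
  simp only [e, LinearEquiv.trans_apply]
  rw [h]
  rfl

variable [IsNoetherianRing R]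

namespace IsDualizing

/-- The presentation in grade zero, where `M` is identified with its bidual. -/
def bidualPresentationZero (H : IsDualizing R S U 0) : BidualPresentation R S U 0 where
  P M _ _ := M
  π M _ _ := 𝟙 M
  x M hM _ :=
    have := isIso_toExt_zero (S := S) (U := U) (freeResolution_isFiniteFree ⟨M, hM⟩).projective
    (Ext.mk₀ (inv (toExt S U (freeResolution ⟨M, hM⟩) 0)) :)
  π_surjective _ _ _ := Function.surjective_id
  compEval_surjective M hM _ y := by
    have := isIso_toExt_zero (S := S) (U := U) (freeResolution_isFiniteFree ⟨M, hM⟩).projective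
    obtain ⟨ψ, rfl⟩ := (Ext.mk₀_bijective _ _).2 y
    obtain ⟨m, hm⟩ := H.evalSurjective_Z (freeResolution_isFiniteFree ⟨M, hM⟩) le_rfl
      (toExt S U (freeResolution ⟨M, hM⟩) 0 ≫ ψ)
    refine ⟨m, (Ext.mk₀_comp_mk₀ _ _).trans ?_⟩
    erw [hm, IsIso.inv_hom_id_assoc]
  compEval_eq_zero_iff M hM _ m := by
    have := isIso_toExt_zero (S := S) (U := U) (freeResolution_isFiniteFree ⟨M, hM⟩).projective
    constructor
    · intro h
      have h' := (Ext.mk₀_eq_zero_iff _).1 ((Ext.mk₀_comp_mk₀ _ _).symm.trans h)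
      exact H.eq_zero_of_evalAt_eq_zero_Z (freeResolution_isFiniteFree ⟨M, hM⟩) le_rfl m
        ((cancel_epi (inv (toExt S U (freeResolution ⟨M, hM⟩) 0))).1
          (h'.trans Limits.comp_zero.symm))
    · rintro (rfl : m = 0)
      exact map_zero (compEval _).hom
  exists_lift M hM _ M' hM' _ f := by
    obtain ⟨φ, rfl⟩ := SyzygySequence.exists_lift (freeResolution ⟨M, hM⟩)
      (freeResolution ⟨M', hM'⟩) (freeResolution_isFiniteFree ⟨M, hM⟩).projective f
    have := isIso_toExt_zero (S := S) (U := U) (freeResolution_isFiniteFree ⟨M, hM⟩).projective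
    have := isIso_toExt_zero (S := S) (U := U) (freeResolution_isFiniteFree ⟨M', hM'⟩).projective
    exact ⟨φ.z 0, (Category.comp_id _).trans (Category.id_comp _).symm,
      (Ext.mk₀_comp_mk₀ _ _).trans ((congrArg Ext.mk₀ (inv_toExt_zero_naturality φ)).trans
        (Ext.mk₀_comp_mk₀ _ _).symm)⟩

/-- The presentation in positive grade, by the first term of a free resolution. -/
def bidualPresentationSucc {k : ℕ} (H : IsDualizing R S U (k + 1)) :
    BidualPresentation R S U (k + 1) where
  P M hM _ := (freeResolution ⟨M, hM⟩).P 0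
  π M hM _ := (freeResolution ⟨M, hM⟩).π 0
  x M hM hg := (gradeSplice S (r := freeResolution ⟨M, hM⟩)
    (freeResolution_isFiniteFree ⟨M, hM⟩).projective hg).yonedaClass
  π_surjective M hM _ := freeCover_surjective M
  compEval_surjective M hM hg y := by
    have hr := freeResolution_isFiniteFree ⟨M, hM⟩
    obtain ⟨x, hx⟩ := (gradeSplice S hr.projective hg).yonedaClass_comp_surjective
      ⟨H.subsingleton_ext_dual_P hr, H.subsingleton_ext_dual_Z hr le_rfl⟩ 0 (k + 1) rfl y
    obtain ⟨ψ, rfl⟩ := (Ext.mk₀_bijective _ _).2 x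
    obtain ⟨p, rfl⟩ := H.evalSurjective_P hr 0 ψ
    exact ⟨p, hx⟩
  compEval_eq_zero_iff M hM hg p := by
    have hr := freeResolution_isFiniteFree ⟨M, hM⟩
    refine ((gradeSplice S hr.projective hg).yonedaClass_comp_mk₀_eq_zero_iff
      ⟨H.subsingleton_ext_dual_P hr, H.subsingleton_ext_dual_Z hr le_rfl⟩
      (H.evalSurjective_P hr) (H.evalSurjective_Z hr le_rfl) (evalAt S U p)).trans ?_
    constructor
    · rintro ⟨z, hz⟩
      rw [H.eq_of_evalAt_eq_P hr (hz.trans (dualMap_comp_evalAt S U _ z))]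
      exact congr($((freeResolution ⟨M, hM⟩).zero 0) z)
    · intro hp
      exact ⟨⟨p, hp⟩, rfl⟩
  exists_lift M hM hg M' hM' hg' f := by
    have hr := freeResolution_isFiniteFree ⟨M, hM⟩
    have hr' := freeResolution_isFiniteFree ⟨M', hM'⟩
    obtain ⟨φ, rfl⟩ := SyzygySequence.exists_lift (freeResolution ⟨M, hM⟩)
      (freeResolution ⟨M', hM'⟩) hr.projective f
    refine ⟨φ.p 0, φ.π_comm 0, ?_⟩
    refine DualSplice.yonedaClass_naturality (gradeSplice S hr.projective hg)
      (gradeSplice S hr'.projective hg') φ _ _ (toExt_naturality S U φ (k + 1)) ?_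
    change dualMap S U (φ.p 0) ≫ dualMap S U _ = dualMap S U _ ≫ dualMap S U _
    rw [← dualMap_comp, ← dualMap_comp, φ.ι_comm]

/-- The presentation that identifies `M` with `Ext^g_S(Ext^g_R(M, U), U)`. -/
def bidualPresentation : ∀ {g : ℕ}, IsDualizing R S U g → BidualPresentation R S U g
  | 0, H => H.bidualPresentationZero
  | _ + 1, H => H.bidualPresentationSucc

end IsDualizing

/-- For `M` of grade at least `g`, the module `Ext^g_S(Ext^g_R(M, U), U)` is naturally isomorphic
to `M`. -/
theorem IsDualizing.exists_natural_iso (H : IsDualizing R S U g) :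
    ∃ η : ∀ M : ModuleCat.{u} R, Module.Finite R M → GradeGE R U M g →
        (M ≅ (extFunctor S R U g).obj (op ((extFunctor R S U g).obj (op M)))),
      ∀ M hM hg M' hM' hg' (f : M ⟶ M'),
        f ≫ (η M' hM' hg').hom =
          (η M hM hg).hom ≫ (extFunctor S R U g).map ((extFunctor R S U g).map f.op).op := by
  let p := H.bidualPresentation
  choose η hη using p.exists_hom
  refine ⟨η, fun M hM hg M' hM' hg' f => ?_⟩
  obtain ⟨f', h₁, h₂⟩ := p.exists_lift M hM hg M' hM' hg' f
  have : Epi (p.π M hM hg) := (ModuleCat.epi_iff_surjective _).2 (p.π_surjective M hM hg)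
  rw [← cancel_epi (p.π M hM hg), ← Category.assoc, ← h₁, Category.assoc, hη, ← Category.assoc, hη,
    compEval_naturality _ _ _ _ h₂]

lemma IsDualizing.gradeSubcategory_ext [IsNoetherianRing S] [Module.Finite S U]
    (H : IsDualizing R S U g) (M : ModuleCat.{u} R) (hM : gradeSubcategory R U g M) :
    gradeSubcategory S U g ((extFunctor R S U g).obj (op M)) := by
  obtain ⟨hfin, hge, hlt⟩ := hM
  refine ⟨?_, H.gorenstein.gradeGE_ext M g, fun h => hlt fun j _ => ?_⟩
  · have : Module.Finite S (dual S U ((freeResolution ⟨M, hfin⟩).Z g)) :=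
      have := (syzygy ⟨M, hfin⟩ g).2
      finite_dual (syzygy ⟨M, hfin⟩ g).1
    exact Module.Finite.of_surjective (toExt S U (freeResolution ⟨M, hfin⟩) g).hom
      (toExt_surjective S U (freeResolution_isFiniteFree ⟨M, hfin⟩).projective g)
  · obtain ⟨η, -⟩ := H.exists_natural_iso
    have h₁ : Subsingleton ((extFunctor S R U g).obj (op ((extFunctor R S U g).obj (op M)))) :=
      h g (by lia)
    have h₂ : Subsingleton M := (η M hfin hge).toLinearEquiv.injective.subsingleton
    refine subsingleton_of_forall_eq 0 fun x => ?_
    rw [← Ext.mk₀_id_comp x, (ModuleCat.isZero_of_subsingleton M).eq_of_src (𝟙 M) 0,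
      Ext.mk₀_zero, Ext.zero_comp]

/-- If `U` is dualizing on both sides, then `Ext^g_R(-, U)` is a duality between the modules of
grade `g`. -/
theorem IsDualizing.isEquivalence_lift [IsNoetherianRing S] [Module.Finite R U]
    (H : IsDualizing R S U g) (H' : IsDualizing S R U g)
    (h : ∀ M : (gradeSubcategory R U g).FullSubcategoryᵒᵖ, gradeSubcategory S U g
      (((gradeSubcategory R U g).ι.op ⋙ extFunctor R S U g).obj M)) :
    ((gradeSubcategory S U g).lift
      ((gradeSubcategory R U g).ι.op ⋙ extFunctor R S U g) h).IsEquivalence := by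
  obtain ⟨η, hη⟩ := H.exists_natural_iso
  obtain ⟨θ, hθ⟩ := H'.exists_natural_iso
  let F := (gradeSubcategory S U g).lift ((gradeSubcategory R U g).ι.op ⋙ extFunctor R S U g) h
  let G := (gradeSubcategory R U g).lift ((gradeSubcategory S U g).ι.op ⋙ extFunctor S R U g)
    fun N => H'.gradeSubcategory_ext N.unop.obj N.unop.property
  let unit : 𝟭 _ ≅ F ⋙ G.rightOp := NatIso.ofComponents
    (fun M => (((gradeSubcategory R U g).isoMk (Y := G.obj (op (F.obj M)))
      (η M.unop.obj M.unop.property.1 M.unop.property.2.1)).op).symm) (fun {M N} f => by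
        refine Quiver.Hom.unop_inj (ObjectProperty.hom_ext _ ?_)
        change (η N.unop.obj _ _).inv ≫ f.unop.hom =
          (extFunctor S R U g).map ((extFunctor R S U g).map f.unop.hom.op).op ≫
            (η M.unop.obj _ _).inv
        rw [Iso.inv_comp_eq, ← Category.assoc, ← hη _ _ _ _ M.unop.property.1 M.unop.property.2.1,
          Category.assoc, Iso.hom_inv_id, Category.comp_id])
  let counit : G.rightOp ⋙ F ≅ 𝟭 _ := NatIso.ofComponents
    (fun N => ((gradeSubcategory S U g).isoMk (Y := F.obj (op (G.obj (op N))))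
      (θ N.obj N.property.1 N.property.2.1)).symm) (fun {M N} f => by
        refine ObjectProperty.hom_ext _ ?_
        change (extFunctor R S U g).map ((extFunctor S R U g).map f.hom.op).op ≫
          (θ N.obj _ _).inv = (θ M.obj _ _).inv ≫ f.hom
        rw [Iso.eq_inv_comp, ← Category.assoc, ← hθ _ _ _ _ N.property.1 N.property.2.1,
          Category.assoc, Iso.hom_inv_id, Category.comp_id])
  exact (CategoryTheory.Equivalence.mk F G.rightOp unit counit).isEquivalence_functor

end Bidual

end DualTheory

end

theorem theorem4p1
    (Λ Γ U : Type u) [Ring Λ] [Ring Γ] [AddCommGroup U] [Module Λ U] [Module Γᵐᵒᵖ U]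
    -- `U` is a `Λ`-`Γ`-bimodule (the second instance is the first one read backwards)
    [SMulCommClass Λ Γᵐᵒᵖ U] [SMulCommClass Γᵐᵒᵖ Λ U]
    -- `Λ` and `Γ` are left and right noetherian
    [IsNoetherianRing Λ] [IsNoetherianRing Λᵐᵒᵖ] [IsNoetherianRing Γ] [IsNoetherianRing Γᵐᵒᵖ]
    [Module.Finite Λ U] [Module.Finite Γᵐᵒᵖ U]
    (hbal : DualTheory.IsFaithfullyBalanced Λ Γ U)
    (hself : DualTheory.IsSelforthogonal Λ Γ U)
    (hGor : DualTheory.IsGorensteinBimodule Λ Γ U)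
    (g : ℕ) (hr : injectiveDimension (ModuleCat.of Γᵐᵒᵖ U) = g) :
    (∀ M : ModuleCat.{u} Λ, DualTheory.gradeSubcategory Λ U g M →
      Nonempty (M ≅ (DualTheory.extFunctor Γᵐᵒᵖ Λ U g).obj
        (op ((DualTheory.extFunctor Λ Γᵐᵒᵖ U g).obj (op M))))) ∧
    (injectiveDimension (ModuleCat.of Λ U) = g →
      -- `Ext^g_Λ(-, U)` maps modules of grade `g` to modules of grade `g`, and the induced
      -- contravariant functor is an equivalence
      ∃ h : ∀ M : (DualTheory.gradeSubcategory Λ U g).FullSubcategoryᵒᵖ,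
          DualTheory.gradeSubcategory Γᵐᵒᵖ U g
            (((DualTheory.gradeSubcategory Λ U g).ι.op ⋙
              DualTheory.extFunctor Λ Γᵐᵒᵖ U g).obj M),
        ((DualTheory.gradeSubcategory Γᵐᵒᵖ U g).lift
          ((DualTheory.gradeSubcategory Λ U g).ι.op ⋙
            DualTheory.extFunctor Λ Γᵐᵒᵖ U g) h).IsEquivalence) := by
  have H : DualTheory.IsDualizing Λ Γᵐᵒᵖ U g :=
    ⟨hbal.1, fun j => (hself (j + 1) (by lia)).2, hGor.2,
      (injectiveDimension_le_iff _ g).1 hr.le⟩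
  refine ⟨fun M hM => ?_, fun hl => ?_⟩
  · obtain ⟨η, -⟩ := H.exists_natural_iso
    exact ⟨η M hM.1 hM.2.1⟩
  · have H' : DualTheory.IsDualizing Γᵐᵒᵖ Λ U g :=
      ⟨hbal.2, fun j => (hself (j + 1) (by lia)).1, hGor.1,
        (injectiveDimension_le_iff _ g).1 hl.le⟩
    exact ⟨fun M => H.gradeSubcategory_ext M.unop.obj M.unop.property,
      H.isEquivalence_lift H' _⟩
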